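/- Let $K$ be a set of individual constants and $P$ a set of monadic predicate constants, and let $L^2_{K,P}$ be the monadic second-order language over trees with these constants, the binary predicates parent, domination, proper domination, left-of and equality, and quantification over nodes and over sets of nodes. A tree is a tree domain $D\subseteq\mathbb{N}^*$ (non-empty, closed under prefixes, and with $wi\in D$, $j<i$ implying $wj\in D$) with an interpretation of each $k\in K$ as a node and of each $p\in P$ as a set of nodes; the binary predicates have their natural interpretation on $D$. A set of trees is definable in $L^2_{K,P}$ if it is the set of all trees (finite or infinite) that satisfy some finite set of sentences of $L^2_{K,P}$. Theorem. Let $\mathcal{T}$ be a set of trees that is definable in $L^2_{K,P}$, all of whose members are finite, and for which some $n$ bounds the number of children of every node of every member. Let $K_0\subseteq K$ and $P_0\subseteq P$ be finite (for instance $K_0=K$ and $P_0=P$ if these are finite, or the sets of constants that occur in the defining sentences). View each tree of $\mathcal{T}$ as a labeled tree, the label of a node being the pair of the set of those $k\in K_0$ that name the node and the set of those $p\in P_0$ that hold of it. Then there are a finite terminal alphabet, a finite nonterminal alphabet, a finite set $\mathcal{G}$ of context-free grammars over them, each with its own start symbol and its own finite set of productions, and a map $\pi$ from symbols to labels such that the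 set of labeled trees so obtained from $\mathcal{T}$ is exactly the set of trees that result from the derivation trees of the grammars in $\mathcal{G}$ by replacing each node label $\sigma$ by $\pi(\sigma)$. Here a derivation tree of a grammar is a finite tree domain, labeled with symbols, whose root is labeled with the start symbol, in which nodes labeled with terminals have no children, and in which for each node labeled with a nonterminal $A$ there is a production $A\to\alpha$ such that $\alpha$ is the sequence of the labels of its children from left to right (so $\alpha=\varepsilon$ gives a node without children). The grammars can be chosen such that the only production with empty right-hand side, if any, is the one for the start symbol, and it is present only if the start symbol is on no right-hand side; thus all leaves of a derivation tree with more than one node are labeled with terminals. -/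

import Mathlib

namespace LKP

universe u v w

/-! ## The monadic second-order language over `K` and `P` -/

/-- Individual terms: individual variables (indexed by `ℕ`) and individual constants. -/
inductive Term (K : Type u) : Type u
  | var (n : ℕ) : Term K
  | const (k : K) : Term K

/-- Formulas. `all`/`ex` bind individual variables, `allSet`/`exSet` bind set variables; the two
sorts of variables are both indexed by `ℕ`. -/
inductive Formula (K : Type u) (P : Type v) : Type (max u v)
  | parent (s t : Term K) : Formula K P
  | dom (s t : Term K) : Formula K P
  | properDom (s t : Term K) : Formula K P
  | leftOf (s t : Term K) : Formula K P
  | eq (s t : Term K) : Formula K P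
  | pred (p : P) (t : Term K) : Formula K P
  | mem (X : ℕ) (t : Term K) : Formula K P
  | neg (φ : Formula K P) : Formula K P
  | and (φ ψ : Formula K P) : Formula K P
  | or (φ ψ : Formula K P) : Formula K P
  | imp (φ ψ : Formula K P) : Formula K P
  | iff (φ ψ : Formula K P) : Formula K P
  | all (x : ℕ) (φ : Formula K P) : Formula K P
  | ex (x : ℕ) (φ : Formula K P) : Formula K P
  | allSet (X : ℕ) (φ : Formula K P) : Formula K P
  | exSet (X : ℕ) (φ : Formula K P) : Formula K P

/-- The individual variables of a term. -/
def Term.vars {K : Type u} : Term K → Set ℕ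
  | .var n => {n}
  | .const _ => ∅

/-- The free individual variables of a formula. -/
def Formula.freeInd {K : Type u} {P : Type v} : Formula K P → Set ℕ
  | .parent s t | .dom s t | .properDom s t | .leftOf s t | .eq s t => s.vars ∪ t.vars
  | .pred _ t | .mem _ t => t.vars
  | .neg φ | .allSet _ φ | .exSet _ φ => φ.freeInd
  | .and φ ψ | .or φ ψ | .imp φ ψ | .iff φ ψ => φ.freeInd ∪ ψ.freeInd
  | .all x φ | .ex x φ => φ.freeInd \ {x}

/-- The free set variables of a formula. -/
def Formula.freeSet {K : Type u} {P : Type v} : Formula K P → Set ℕ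
  | .parent _ _ | .dom _ _ | .properDom _ _ | .leftOf _ _ | .eq _ _ | .pred _ _ => ∅
  | .mem X _ => {X}
  | .neg φ | .all _ φ | .ex _ φ => φ.freeSet
  | .and φ ψ | .or φ ψ | .imp φ ψ | .iff φ ψ => φ.freeSet ∪ ψ.freeSet
  | .allSet X φ | .exSet X φ => φ.freeSet \ {X}

/-- A sentence is a formula without free variables of either sort. -/
def Formula.IsSentence {K : Type u} {P : Type v} (φ : Formula K P) : Prop :=
  φ.freeInd = ∅ ∧ φ.freeSet = ∅

/-- Models. Proper domination is a defined predicate and has no component of its own. -/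
structure Model (K : Type u) (P : Type v) where
  U : Type
  nonempty : Nonempty U
  const : K → U
  parent : U → U → Prop
  dom : U → U → Prop
  leftOf : U → U → Prop
  pred : P → Set U

/-- The value of a term under an assignment to the individual variables. -/
def Model.val {K : Type u} {P : Type v} (M : Model K P) (s : ℕ → M.U) : Term K → M.U
  | .var n => s n
  | .const k => M.const k

/-- Satisfaction relative to an assignment `s` of individuals and `S` of sets. -/
def Model.Sat {K : Type u} {P : Type v} (M : Model K P) :
    (ℕ → M.U) → (ℕ → Set M.U) → Formula K P → Prop
  | s, _, .parent a b => M.parent (M.val s a) (M.val s b)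
  | s, _, .dom a b => M.dom (M.val s a) (M.val s b)
  | s, _, .properDom a b => M.dom (M.val s a) (M.val s b) ∧ M.val s a ≠ M.val s b
  | s, _, .leftOf a b => M.leftOf (M.val s a) (M.val s b)
  | s, _, .eq a b => M.val s a = M.val s b
  | s, _, .pred p a => M.val s a ∈ M.pred p
  | s, S, .mem X a => M.val s a ∈ S X
  | s, S, .neg φ => ¬ M.Sat s S φ
  | s, S, .and φ ψ => M.Sat s S φ ∧ M.Sat s S ψ
  | s, S, .or φ ψ => M.Sat s S φ ∨ M.Sat s S ψ
  | s, S, .imp φ ψ => M.Sat s S φ → M.Sat s S ψ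
  | s, S, .iff φ ψ => (M.Sat s S φ ↔ M.Sat s S ψ)
  | s, S, .all x φ => ∀ a : M.U, M.Sat (Function.update s x a) S φ
  | s, S, .ex x φ => ∃ a : M.U, M.Sat (Function.update s x a) S φ
  | s, S, .allSet X φ => ∀ A : Set M.U, M.Sat s (Function.update S X A) φ
  | s, S, .exSet X φ => ∃ A : Set M.U, M.Sat s (Function.update S X A) φ

/-- `M` satisfies `φ` under every assignment. -/
def Model.Models {K : Type u} {P : Type v} (M : Model K P) (φ : Formula K P) : Prop :=
  ∀ (s : ℕ → M.U) (S : ℕ → Set M.U), M.Sat s S φ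

/-! ## Tree domains and the intended models -/

/-- Tree domains: sets of node addresses; `w ++ [i]` is the `i`-th child of `w`. -/
structure TreeDomain where
  carrier : Set (List ℕ)
  nonempty : carrier.Nonempty
  prefix_mem : ∀ x y : List ℕ, x ++ y ∈ carrier → x ∈ carrier
  sibling_mem : ∀ (x : List ℕ) (i j : ℕ), x ++ [i] ∈ carrier → j < i → x ++ [j] ∈ carrier

theorem TreeDomain.root_mem (D : TreeDomain) : [] ∈ D.carrier :=
  D.nonempty.elim fun x hx => D.prefix_mem [] x hx

/-- Trees: a tree domain with interpretations of the individual and predicate constants. -/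
structure Tree (K : Type u) (P : Type v) where
  domain : TreeDomain
  const : K → domain.carrier
  pred : P → Set domain.carrier

/-- The intended model given by a tree: parent, domination and left-of have their natural
interpretation on the tree domain. -/
def Tree.toModel {K : Type u} {P : Type v} (M : Tree K P) : Model K P where
  U := M.domain.carrier
  nonempty := M.domain.nonempty.to_subtype
  const := M.const
  parent x y := ∃ i : ℕ, y.1 = x.1 ++ [i]
  dom x y := ∃ z : List ℕ, y.1 = x.1 ++ z
  leftOf x y := ∃ (z a b : List ℕ) (i j : ℕ), i < j ∧ x.1 = z ++ i :: a ∧ y.1 = z ++ j :: b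
  pred := M.pred

/-- The set of trees that satisfy all the sentences in `Φ`. -/
def Mod {K : Type u} {P : Type v} (Φ : Set (Formula K P)) : Set (Tree K P) :=
  {M | ∀ φ ∈ Φ, M.toModel.Models φ}

/-- A set of trees is definable if it is the set of trees satisfying finitely many sentences. -/
def Definable {K : Type u} {P : Type v} (𝒯 : Set (Tree K P)) : Prop :=
  ∃ Φ : Set (Formula K P), Φ.Finite ∧ (∀ φ ∈ Φ, φ.IsSentence) ∧ 𝒯 = Mod Φ

/-- All members are finite trees. -/
def AllFinite {K : Type u} {P : Type v} (𝒯 : Set (Tree K P)) : Prop :=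
  ∀ M ∈ 𝒯, M.domain.carrier.Finite

/-- Some `n` bounds the number of children of every node of every member. -/
def BoundedBranching {K : Type u} {P : Type v} (𝒯 : Set (Tree K P)) : Prop :=
  ∃ n : ℕ, ∀ M ∈ 𝒯, ∀ (x : List ℕ) (i : ℕ), x ++ [i] ∈ M.domain.carrier → i < n

/-! ## Labeled trees, projections, derivation trees -/

/-- A tree domain with every node labeled by an element of `Λ`. -/
structure LabeledTree (Λ : Type w) where
  domain : TreeDomain
  label : domain.carrier → Λ

/-- The projection induced by a map of labels. -/
def LabeledTree.map {Λ : Type u} {Λ' : Type v} (π : Λ → Λ') (D : LabeledTree Λ) :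
    LabeledTree Λ' where
  domain := D.domain
  label x := π (D.label x)

/-- A tree as a labeled tree, as far as the symbols in `K₀` and `P₀` are concerned: a node is
labeled with the constants of `K₀` naming it and the predicates of `P₀` true of it. -/
def Tree.labeled {K : Type u} {P : Type v} (K₀ : Set K) (P₀ : Set P) (M : Tree K P) :
    LabeledTree (Set K × Set P) where
  domain := M.domain
  label x := ({k | k ∈ K₀ ∧ M.const k = x}, {p | p ∈ P₀ ∧ x ∈ M.pred p})

/-- `D` is a derivation tree of `g`: it is finite, its root is labeled with the start symbol,
nodes labeled with terminals have no children, and for each node labeled with a nonterminal `A`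
there is a production for `A` whose right-hand side lists the labels of the children from left to
right (an empty right-hand side means that there are no children). -/
structure IsDerivationTree {T : Type w} (g : ContextFreeGrammar T)
    (D : LabeledTree (Symbol T g.NT)) : Prop where
  finite : D.domain.carrier.Finite
  root : D.label ⟨[], D.domain.root_mem⟩ = Symbol.nonterminal g.initial
  terminal : ∀ (x : D.domain.carrier) (a : T), D.label x = Symbol.terminal a →
    ∀ i : ℕ, x.1 ++ [i] ∉ D.domain.carrier
  nonterminal : ∀ (x : D.domain.carrier) (A : g.NT), D.label x = Symbol.nonterminal A →
    ∃ r ∈ g.rules, r.input = A ∧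
      (∀ i : ℕ, x.1 ++ [i] ∈ D.domain.carrier ↔ i < r.output.length) ∧
      ∀ (i : ℕ) (h : x.1 ++ [i] ∈ D.domain.carrier), r.output[i]? = some (D.label ⟨x.1 ++ [i], h⟩)

/-- The only production with an empty right-hand side that `g` may have is the one for the start
symbol, and it may have that one only if the start symbol is on no right-hand side. Thus the leaves
of a derivation tree with more than one node are labeled with terminals. -/
def EmptyOnlyAtStart {T : Type w} (g : ContextFreeGrammar T) : Prop :=
  ∀ r ∈ g.rules, r.output = [] →
    r.input = g.initial ∧ ∀ r' ∈ g.rules, Symbol.nonterminal g.initial ∉ r'.output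

/-- The grammar with nonterminals `N`, start symbol `G.1` and productions `G.2`. -/
abbrev grammar {T N : Type} (G : N × Finset (ContextFreeRule T N)) : ContextFreeGrammar T :=
  ⟨N, G.1, G.2⟩

/-- The set of trees generated by a set of grammars over common alphabets: all derivation trees
of its members. -/
def generatedTrees {T N : Type} (𝒢 : Set (N × Finset (ContextFreeRule T N))) :
    Set (LabeledTree (Symbol T N)) :=
  {D | ∃ G ∈ 𝒢, IsDerivationTree (grammar G) D}

end LKP

namespace LKP

universe u v w

/-! ## Recognizable properties of labeled trees -/

/-! This is the route from monadic second-order logic through finite algebras of trees to local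
(context-free) tree sets. A property of labeled trees is `Recognizable` if it is decided by a
finite-valued function `h` whose value at a tree depends only on the root label, on which children
the root has, and on the values at their subtrees. Nothing here needs finiteness or bounded
branching.

A model with assignments is coded by putting marks on nodes, one mark for each variable or constant.
Atomic formulas become recognizable because the tree relations can be evaluated stepwise down the
tree (`IsLocal`, `recognizable_related`). Negation and conjunction are complement and product, and a
quantifier is a relabeling that changes one mark (`Recognizable.exists_relabel`). So every formula
is recognizable (`Formula.isRecognizable`).

For the grammars, the symbols are pairs of a label class and a value of `h`, and the productions are
the local configurations that some tree realizes; bounded branching makes them finite in number. A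
tree of the set is turned into a derivation tree by annotating its nodes. Conversely, labels
realizing the productions are chosen at each node of a derivation tree, and since the tree is
finite, induction from the leaves shows that the annotated values are the true ones
(`IsDerivationTree.exists_labeling`). The accepted values at the root select the grammars. -/

/-- Non-empty prefix-closed sets of addresses. -/
def IsRooted (D : Set (List ℕ)) : Prop :=
  [] ∈ D ∧ ∀ x y : List ℕ, x ++ y ∈ D → x ∈ D

theorem TreeDomain.isRooted (D : TreeDomain) : IsRooted D.carrier :=
  ⟨D.root_mem, D.prefix_mem⟩

theorem IsRooted.head_mem {D : Set (List ℕ)} (hD : IsRooted D) {i : ℕ} {y : List ℕ}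
    (h : i :: y ∈ D) : [i] ∈ D :=
  hD.2 [i] y h

/-- The domain of the subtree at `x`. -/
def subdomain (D : Set (List ℕ)) (x : List ℕ) : Set (List ℕ) :=
  {y | x ++ y ∈ D}

/-- The labeling of the subtree at `x`. -/
def sublabel {Λ : Type w} (L : List ℕ → Λ) (x : List ℕ) : List ℕ → Λ :=
  fun y => L (x ++ y)

theorem subdomain_subdomain (D : Set (List ℕ)) (x y : List ℕ) :
    subdomain (subdomain D x) y = subdomain D (x ++ y) := by
  ext z; simp [subdomain]

theorem sublabel_sublabel {Λ : Type w} (L : List ℕ → Λ) (x y : List ℕ) :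
    sublabel (sublabel L x) y = sublabel L (x ++ y) := by
  ext z; simp [sublabel]

theorem IsRooted.subdomain {D : Set (List ℕ)} (hD : IsRooted D) {x : List ℕ} (hx : x ∈ D) :
    IsRooted (subdomain D x) :=
  ⟨by simpa [LKP.subdomain] using hx, fun y z h => hD.2 (x ++ y) z (by
    simpa [LKP.subdomain] using h)⟩

/-- The value of `h` at a tree is determined by the root label and the values at the subtrees of the
children of the root. -/
def IsCongruence {Λ : Type w} {Q : Type} (h : Set (List ℕ) → (List ℕ → Λ) → Q) : Prop :=
  ∀ (D D' : Set (List ℕ)) (L L' : List ℕ → Λ), IsRooted D → IsRooted D' → L [] = L' [] →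
    (∀ i, [i] ∈ D ↔ [i] ∈ D') →
    (∀ i, [i] ∈ D → h (subdomain D [i]) (sublabel L [i]) =
      h (subdomain D' [i]) (sublabel L' [i])) →
    h D L = h D' L'

/-- Properties of labeled trees that are decided by a finite-valued congruence. -/
def Recognizable {Λ : Type w} (𝓛 : Set (List ℕ) → (List ℕ → Λ) → Prop) : Prop :=
  ∃ (Q : Type) (_ : Finite Q) (h : Set (List ℕ) → (List ℕ → Λ) → Q) (F : Set Q),
    IsCongruence h ∧ ∀ D L, 𝓛 D L ↔ h D L ∈ F

/-! ### Closure of recognizability under Boolean operations and relabeling -/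

section Closure

variable {Λ : Type w} {𝓛 𝓛' : Set (List ℕ) → (List ℕ → Λ) → Prop}

theorem Recognizable.true : Recognizable (Λ := Λ) fun _ _ => True :=
  ⟨Unit, inferInstance, fun _ _ => (), Set.univ, fun _ _ _ _ _ _ _ _ _ => rfl, by simp⟩

theorem Recognizable.not (h : Recognizable 𝓛) : Recognizable fun D L => ¬ 𝓛 D L := by
  obtain ⟨Q, hQ, f, F, hf, hF⟩ := h
  exact ⟨Q, hQ, f, Fᶜ, hf, fun D L => not_congr (hF D L)⟩

theorem Recognizable.and (h : Recognizable 𝓛) (h' : Recognizable 𝓛') :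
    Recognizable fun D L => 𝓛 D L ∧ 𝓛' D L := by
  obtain ⟨Q, hQ, f, F, hf, hF⟩ := h
  obtain ⟨Q', hQ', f', F', hf', hF'⟩ := h'
  refine ⟨Q × Q', inferInstance, fun D L => (f D L, f' D L), F ×ˢ F', ?_, fun D L => ?_⟩
  · intro D D' L L' hD hD' h0 hc hr
    exact Prod.ext (hf D D' L L' hD hD' h0 hc fun i hi => congrArg Prod.fst (hr i hi))
      (hf' D D' L L' hD hD' h0 hc fun i hi => congrArg Prod.snd (hr i hi))
  · simp [hF, hF']

theorem Recognizable.forall_mem {ι : Type u} {I : Set ι} (hI : I.Finite)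
    (𝓕 : ι → Set (List ℕ) → (List ℕ → Λ) → Prop) (h : ∀ i ∈ I, Recognizable (𝓕 i)) :
    Recognizable fun D L => ∀ i ∈ I, 𝓕 i D L := by
  induction I, hI using Set.Finite.induction_on with
  | empty => simpa using Recognizable.true
  | @insert a I _ _ ih =>
    have := (h a (by simp)).and (ih fun i hi => h i (by simp [hi]))
    simpa using this

/-- Existential quantification over relabelings. -/
theorem Recognizable.exists_relabel (r : Λ → Λ → Prop) (h : Recognizable 𝓛) :
    Recognizable fun D L => ∃ L', (∀ x ∈ D, r (L x) (L' x)) ∧ 𝓛 D L' := by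
  obtain ⟨Q, hQ, f, F, hf, hF⟩ := h
  -- One inclusion between the sets of attainable values; the other follows by exchanging the two
  -- trees.
  have key : ∀ (D D' : Set (List ℕ)) (L L' : List ℕ → Λ), IsRooted D → IsRooted D' →
      L [] = L' [] → (∀ i, [i] ∈ D ↔ [i] ∈ D') →
      (∀ i, [i] ∈ D → {q | ∃ M, (∀ x ∈ subdomain D [i], r (sublabel L [i] x) (M x)) ∧
          f (subdomain D [i]) M = q} ⊆
        {q | ∃ M, (∀ x ∈ subdomain D' [i], r (sublabel L' [i] x) (M x)) ∧
          f (subdomain D' [i]) M = q}) →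
      {q | ∃ M, (∀ x ∈ D, r (L x) (M x)) ∧ f D M = q} ⊆
        {q | ∃ M, (∀ x ∈ D', r (L' x) (M x)) ∧ f D' M = q} := by
    rintro D D' L L' hD hD' h0 hc hr _ ⟨M, hM, rfl⟩
    have hch : ∀ i, ∃ N : List ℕ → Λ, [i] ∈ D →
        (∀ x ∈ subdomain D' [i], r (sublabel L' [i] x) (N x)) ∧
          f (subdomain D' [i]) N = f (subdomain D [i]) (sublabel M [i]) := by
      intro i
      by_cases hi : [i] ∈ D
      · obtain ⟨N, hN, hN'⟩ := hr i hi ⟨sublabel M [i], fun x hx => hM _ hx, rfl⟩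
        exact ⟨N, fun _ => ⟨hN, hN'⟩⟩
      · exact ⟨M, fun h => absurd h hi⟩
    choose N hN using hch
    -- The relabelings chosen independently for the subtrees are glued together under the old root
    -- label.
    refine ⟨fun x => match x with
      | [] => M []
      | i :: y => N i y, ?_, ?_⟩
    · rintro (_ | ⟨i, y⟩) hx
      · exact h0 ▸ hM [] hD.1
      · exact (hN i ((hc i).2 (hD'.head_mem hx))).1 y hx
    · symm
      refine hf D D' M _ hD hD' ?_ hc ?_
      · rfl
      · exact fun i hi => (hN i hi).2.symm
  -- Subset construction: the new value of a tree collects the old values of all its admissible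
  -- relabelings.
  refine ⟨Set Q, inferInstance, fun D L => {q | ∃ M, (∀ x ∈ D, r (L x) (M x)) ∧ f D M = q},
    {A | (A ∩ F).Nonempty}, ?_, ?_⟩
  · intro D D' L L' hD hD' h0 hc hr
    exact (key D D' L L' hD hD' h0 hc fun i hi => (hr i hi).subset).antisymm
      (key D' D L' L hD' hD h0.symm (fun i => (hc i).symm)
        fun i hi => (hr i ((hc i).2 hi)).superset)
  · intro D L
    constructor
    · rintro ⟨M, hM, hM'⟩
      exact ⟨f D M, ⟨M, hM, rfl⟩, (hF D M).1 hM'⟩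
    · rintro ⟨_, ⟨M, hM, rfl⟩, hM'⟩
      exact ⟨M, hM, (hF D M).2 hM'⟩

end Closure

/-! ### Recognizability of relations between marked nodes -/

section Marks

variable {α : Type w}

/-- Some node carries the mark `a`. -/
def Occurs (a : α) (D : Set (List ℕ)) (L : List ℕ → Set α) : Prop :=
  ∃ x ∈ D, a ∈ L x

/-- A node marked `a` is in the relation `R` to a node marked `b`. -/
def Related (R : List ℕ → List ℕ → Prop) (a b : α) (D : Set (List ℕ)) (L : List ℕ → Set α) :
    Prop :=
  ∃ x ∈ D, ∃ y ∈ D, a ∈ L x ∧ b ∈ L y ∧ R x y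

/-- Exactly one node carries the mark `a`. -/
def OccursOnce (a : α) (D : Set (List ℕ)) (L : List ℕ → Set α) : Prop :=
  ∃ x ∈ D, ∀ y ∈ D, a ∈ L y ↔ x = y

/-- Relations between addresses that can be evaluated step by step down the tree. -/
structure IsLocal (R : List ℕ → List ℕ → Prop) : Prop where
  cons_cons : ∀ i x y, R (i :: x) (i :: y) ↔ R x y
  branch : ∀ i j x y x' y', i ≠ j → R (i :: x) (j :: y) → R (i :: x') (j :: y')
  root_left : ∀ i y, R [] (i :: y) → y = [] ∨ ∀ y', R [] (i :: y')
  root_right : ∀ i x x', R (i :: x) [] → R (i :: x') []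

theorem Occurs.transfer {a : α} {D D' : Set (List ℕ)} {L L' : List ℕ → Set α} (hD : IsRooted D)
    (hD' : IsRooted D') (h0 : L [] = L' [])
    (hr : ∀ i, [i] ∈ D → Occurs a (subdomain D [i]) (sublabel L [i]) →
      Occurs a (subdomain D' [i]) (sublabel L' [i])) (h : Occurs a D L) : Occurs a D' L' := by
  obtain ⟨_ | ⟨i, x⟩, hx, ha⟩ := h
  · exact ⟨[], hD'.1, h0 ▸ ha⟩
  · obtain ⟨y, hy, hy'⟩ := hr i (hD.head_mem hx) ⟨x, hx, ha⟩
    exact ⟨i :: y, hy, hy'⟩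

/-- Two nodes below the same child are handled by `hr`. In the other cases locality lets each
non-root node move freely within its child's subtree, so that occurrence of the mark suffices. The
exception is a relation, such as parent, that holds from the root only to the child itself; this is
what `hb0` is for. -/
theorem Related.transfer {R : List ℕ → List ℕ → Prop} (hR : IsLocal R) {a b : α}
    {D D' : Set (List ℕ)} {L L' : List ℕ → Set α} (hD : IsRooted D) (hD' : IsRooted D')
    (h0 : L [] = L' []) (hc : ∀ i, [i] ∈ D → [i] ∈ D')
    (ha : ∀ i, [i] ∈ D → Occurs a (subdomain D [i]) (sublabel L [i]) →
      Occurs a (subdomain D' [i]) (sublabel L' [i]))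
    (hb : ∀ i, [i] ∈ D → Occurs b (subdomain D [i]) (sublabel L [i]) →
      Occurs b (subdomain D' [i]) (sublabel L' [i]))
    (hb0 : ∀ i, [i] ∈ D → b ∈ sublabel L [i] [] → b ∈ sublabel L' [i] [])
    (hr : ∀ i, [i] ∈ D → Related R a b (subdomain D [i]) (sublabel L [i]) →
      Related R a b (subdomain D' [i]) (sublabel L' [i]))
    (h : Related R a b D L) : Related R a b D' L' := by
  obtain ⟨_ | ⟨i, x⟩, hx, _ | ⟨j, y⟩, hy, hax, hby, hxy⟩ := h
  · exact ⟨[], hD'.1, [], hD'.1, h0 ▸ hax, h0 ▸ hby, hxy⟩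
  · have hj := hD.head_mem hy
    obtain rfl | hall := hR.root_left j y hxy
    · exact ⟨[], hD'.1, [j], hc j hj, h0 ▸ hax, hb0 j hj hby, hxy⟩
    · obtain ⟨y', hy', hby'⟩ := hb j hj ⟨y, hy, hby⟩
      exact ⟨[], hD'.1, j :: y', hy', h0 ▸ hax, hby', hall y'⟩
  · obtain ⟨x', hx', hax'⟩ := ha i (hD.head_mem hx) ⟨x, hx, hax⟩
    exact ⟨i :: x', hx', [], hD'.1, hax', h0 ▸ hby, hR.root_right i x x' hxy⟩
  · by_cases hij : i = j
    · subst hij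
      obtain ⟨x', hx', y', hy', hax', hby', hxy'⟩ := hr i (hD.head_mem hx)
        ⟨x, hx, y, hy, hax, hby, (hR.cons_cons i x y).1 hxy⟩
      exact ⟨i :: x', hx', i :: y', hy', hax', hby', (hR.cons_cons i x' y').2 hxy'⟩
    · obtain ⟨x', hx', hax'⟩ := ha i (hD.head_mem hx) ⟨x, hx, hax⟩
      obtain ⟨y', hy', hby'⟩ := hb j (hD.head_mem hy) ⟨y, hy, hby⟩
      exact ⟨i :: x', hx', j :: y', hy', hax', hby', hR.branch i j x y x' y' hij hxy⟩

/-- Relatedness alone is not a congruence. It becomes one when the value also records whether each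
mark occurs and whether `b` is at the root. -/
theorem recognizable_related {R : List ℕ → List ℕ → Prop} (hR : IsLocal R) (a b : α) :
    Recognizable (Related R a b) := by
  refine ⟨Prop × Prop × Prop × Prop, inferInstance,
    fun D L => (Occurs a D L, Occurs b D L, b ∈ L [], Related R a b D L),
    {q | q.2.2.2}, ?_, fun _ _ => Iff.rfl⟩
  intro D D' L L' hD hD' h0 hc hr
  simp only [Prod.mk.injEq, eq_iff_iff] at hr ⊢
  have hr' := fun i hi => hr i ((hc i).2 hi)
  refine ⟨⟨.transfer hD hD' h0 fun i hi => (hr i hi).1.1,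
      .transfer hD' hD h0.symm fun i hi => (hr' i hi).1.2⟩,
    ⟨.transfer hD hD' h0 fun i hi => (hr i hi).2.1.1,
      .transfer hD' hD h0.symm fun i hi => (hr' i hi).2.1.2⟩, by rw [h0], ?_, ?_⟩
  · exact .transfer hR hD hD' h0 (fun i => (hc i).1) (fun i hi => (hr i hi).1.1)
      (fun i hi => (hr i hi).2.1.1) (fun i hi => (hr i hi).2.2.1.1)
      fun i hi => (hr i hi).2.2.2.1
  · exact .transfer hR hD' hD h0.symm (fun i => (hc i).2) (fun i hi => (hr' i hi).1.2)
      (fun i hi => (hr' i hi).2.1.2) (fun i hi => (hr' i hi).2.2.1.2)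
      fun i hi => (hr' i hi).2.2.2.2

theorem isLocal_eq : IsLocal Eq where
  cons_cons := by simp
  branch := by intro i j x y x' y' hij h; simp [hij] at h
  root_left := by simp
  root_right := by simp

theorem isLocal_ne : IsLocal Ne where
  cons_cons := by simp
  branch := by intro i j x y x' y' hij _; simp [hij]
  root_left := by simp
  root_right := by simp

theorem isLocal_parent : IsLocal fun x y => ∃ i : ℕ, y = x ++ [i] where
  cons_cons := by simp
  branch := by simp +contextual [eq_comm]
  root_left := by simp +contextual
  root_right := by simp

theorem isLocal_dom : IsLocal fun x y => ∃ z : List ℕ, y = x ++ z where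
  cons_cons := by simp
  branch := by simp +contextual [eq_comm]
  root_left := by simp
  root_right := by simp

theorem isLocal_leftOf : IsLocal fun x y => ∃ (z a b : List ℕ) (i j : ℕ),
    i < j ∧ x = z ++ i :: a ∧ y = z ++ j :: b where
  cons_cons := by
    intro k x y
    constructor
    · rintro ⟨_ | ⟨l, z⟩, a, b, i, j, hij, hx, hy⟩
      · simp at hx hy; omega
      · simp at hx hy
        exact ⟨z, a, b, i, j, hij, hx.2, hy.2⟩
    · rintro ⟨z, a, b, i, j, hij, rfl, rfl⟩
      exact ⟨k :: z, a, b, i, j, hij, rfl, rfl⟩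
  branch := by
    rintro k l x y x' y' hkl ⟨_ | ⟨m, z⟩, a, b, i, j, hij, hx, hy⟩
    · simp at hx hy
      exact ⟨[], x', y', k, l, by omega, rfl, rfl⟩
    · simp at hx hy; omega
  root_left := by simp
  root_right := by simp

/-- Uniqueness is a Boolean combination of `Related` for equality and for inequality, both of which
are local. -/
theorem recognizable_occursOnce (a : α) : Recognizable (OccursOnce a) := by
  have := (recognizable_related isLocal_eq a a).and (recognizable_related isLocal_ne a a).not
  convert this using 3 with D L
  constructor
  · rintro ⟨x, hx, h⟩
    have hax := (h x hx).2 rfl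
    exact ⟨⟨x, hx, x, hx, hax, hax, rfl⟩, fun ⟨y, hy, z, hz, hay, haz, hyz⟩ =>
      hyz (((h y hy).1 hay).symm.trans ((h z hz).1 haz))⟩
  · rintro ⟨⟨x, hx, _, _, hax, _, _⟩, h⟩
    refine ⟨x, hx, fun y hy => ⟨fun hay => ?_, ?_⟩⟩
    · by_contra hxy
      exact h ⟨x, hx, y, hy, hax, hay, hxy⟩
    · rintro rfl; exact hax

end Marks

/-! ## Definable sets of trees are recognizable -/

section Formulas

variable {K : Type u} {P : Type v}

/-- The marks that represent variables and constants in the labels of a tree. -/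
inductive Mark (K : Type u) (P : Type v) : Type (max u v)
  | ind (n : ℕ) : Mark K P
  | set (X : ℕ) : Mark K P
  | const (k : K) : Mark K P
  | pred (p : P) : Mark K P

/-- The mark of a term. -/
def Term.mark (P : Type v) : Term K → Mark K P
  | .var n => .ind n
  | .const k => .const k

/-- The constants of a term. -/
def Term.consts : Term K → Set K
  | .var _ => ∅
  | .const k => {k}

theorem Term.consts_finite (t : Term K) : t.consts.Finite := by
  cases t <;> simp [Term.consts]

/-- The labeling `L` represents the tree `M` and the assignments `s`, `S`, as far as the variables in
`I` and `J` and the constants in `C` are concerned. -/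
structure Represents (I J : Set ℕ) (C : Set K) (M : Tree K P) (s : ℕ → M.domain.carrier)
    (S : ℕ → Set M.domain.carrier) (L : List ℕ → Set (Mark K P)) : Prop where
  ind : ∀ n ∈ I, ∀ x : M.domain.carrier, Mark.ind n ∈ L x ↔ s n = x
  set : ∀ X ∈ J, ∀ x : M.domain.carrier, Mark.set X ∈ L x ↔ x ∈ S X
  const : ∀ k ∈ C, ∀ x : M.domain.carrier, Mark.const k ∈ L x ↔ M.const k = x
  pred : ∀ (p : P) (x : M.domain.carrier), Mark.pred p ∈ L x ↔ x ∈ M.pred p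

theorem Represents.mono {I J I' J' : Set ℕ} {C C' : Set K} {M : Tree K P}
    {s : ℕ → M.domain.carrier} {S : ℕ → Set M.domain.carrier} {L : List ℕ → Set (Mark K P)}
    (h : Represents I J C M s S L) (hI : I' ⊆ I) (hJ : J' ⊆ J) (hC : C' ⊆ C) :
    Represents I' J' C' M s S L :=
  ⟨fun n hn => h.ind n (hI hn), fun X hX => h.set X (hJ hX), fun k hk => h.const k (hC hk), h.pred⟩

theorem Represents.term {I J : Set ℕ} {C : Set K} {M : Tree K P}
    {s : ℕ → M.domain.carrier} {S : ℕ → Set M.domain.carrier} {L : List ℕ → Set (Mark K P)}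
    (h : Represents I J C M s S L) {t : Term K} (hI : t.vars ⊆ I) (hC : t.consts ⊆ C)
    (x : M.domain.carrier) : t.mark P ∈ L x ↔ M.toModel.val s t = x := by
  cases t with
  | var n => exact h.ind n (hI rfl) x
  | const k => exact h.const k (hC rfl) x

/-- `𝓛` decides the truth of `φ` in the trees represented by labelings. -/
def Decides (C : Set K) (𝓛 : Set (List ℕ) → (List ℕ → Set (Mark K P)) → Prop)
    (φ : Formula K P) : Prop :=
  ∀ (M : Tree K P) (s : ℕ → M.domain.carrier) (S : ℕ → Set M.domain.carrier)
    (L : List ℕ → Set (Mark K P)), Represents φ.freeInd φ.freeSet C M s S L →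
    (𝓛 M.domain.carrier L ↔ M.toModel.Sat s S φ)

/-- The truth of `φ` is a recognizable property of the trees that represent models with
assignments. -/
def Formula.IsRecognizable (φ : Formula K P) : Prop :=
  ∃ C : Set K, C.Finite ∧ ∃ 𝓛, Recognizable 𝓛 ∧ Decides C 𝓛 φ

theorem Formula.IsRecognizable.congr {φ ψ : Formula K P} (h : φ.IsRecognizable)
    (hI : φ.freeInd = ψ.freeInd) (hJ : φ.freeSet = ψ.freeSet)
    (hs : ∀ (M : Model K P) s S, M.Sat s S φ ↔ M.Sat s S ψ) : ψ.IsRecognizable := by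
  obtain ⟨C, hC, 𝓛, h𝓛, hd⟩ := h
  exact ⟨C, hC, 𝓛, h𝓛, fun M s S L hL => (hd M s S L (by rwa [hI, hJ])).trans (hs _ _ _)⟩

theorem isRecognizable_of_isLocal {R : List ℕ → List ℕ → Prop} (hR : IsLocal R) (t t' : Term K)
    {φ : Formula K P} (hφ : φ.freeInd = t.vars ∪ t'.vars)
    (hs : ∀ (M : Tree K P) (s : ℕ → M.domain.carrier) (S : ℕ → Set M.domain.carrier),
      M.toModel.Sat s S φ ↔ R (M.toModel.val s t).1 (M.toModel.val s t').1) :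
    φ.IsRecognizable := by
  refine ⟨t.consts ∪ t'.consts, t.consts_finite.union t'.consts_finite, _,
    recognizable_related hR (t.mark P) (t'.mark P), fun M s S L hL => ?_⟩
  have ht := hL.term (t := t) (by simp [hφ]) (by simp)
  have ht' := hL.term (t := t') (by simp [hφ]) (by simp)
  rw [hs]
  constructor
  · rintro ⟨x, hx, y, hy, hax, hby, hxy⟩
    rw [(ht ⟨x, hx⟩).1 hax, (ht' ⟨y, hy⟩).1 hby]
    exact hxy
  · intro h
    exact ⟨_, (M.toModel.val s t).2, _, (M.toModel.val s t').2, (ht _).2 rfl, (ht' _).2 rfl, h⟩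

theorem isRecognizable_of_mark (t : Term K) (m : Mark K P) {φ : Formula K P}
    (hφ : φ.freeInd = t.vars)
    (hs : ∀ (M : Tree K P) (s : ℕ → M.domain.carrier) (S : ℕ → Set M.domain.carrier)
      (L : List ℕ → Set (Mark K P)), Represents φ.freeInd φ.freeSet t.consts M s S L →
      (M.toModel.Sat s S φ ↔ m ∈ L (M.toModel.val s t).1)) :
    φ.IsRecognizable := by
  refine ⟨t.consts, t.consts_finite, _,
    recognizable_related isLocal_eq (t.mark P) m, fun M s S L hL => ?_⟩
  have ht := hL.term (t := t) (by simp [hφ]) (by simp)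
  rw [hs M s S L hL]
  constructor
  · rintro ⟨x, hx, _, _, hax, hbx, rfl⟩
    rw [(ht ⟨x, hx⟩).1 hax]
    exact hbx
  · intro h
    exact ⟨_, (M.toModel.val s t).2, _, (M.toModel.val s t).2, (ht _).2 rfl, h, rfl⟩

theorem Formula.IsRecognizable.neg {φ : Formula K P} (h : φ.IsRecognizable) :
    φ.neg.IsRecognizable := by
  obtain ⟨C, hC, 𝓛, h𝓛, hd⟩ := h
  exact ⟨C, hC, _, h𝓛.not, fun M s S L hL => not_congr (hd M s S L hL)⟩

theorem Formula.IsRecognizable.and {φ ψ : Formula K P} (h : φ.IsRecognizable)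
    (h' : ψ.IsRecognizable) : (φ.and ψ).IsRecognizable := by
  obtain ⟨C, hC, 𝓛, h𝓛, hd⟩ := h
  obtain ⟨C', hC', 𝓛', h𝓛', hd'⟩ := h'
  refine ⟨C ∪ C', hC.union hC', _, h𝓛.and h𝓛', fun M s S L hL => and_congr
    (hd M s S L (hL.mono ?_ ?_ ?_)) (hd' M s S L (hL.mono ?_ ?_ ?_))⟩ <;>
  simp [freeInd, freeSet]

/-! ### Quantifiers as relabelings -/

/-- The labels `A` and `B` differ at most in the mark `m`. -/
def EqExcept {α : Type w} (m : α) (A B : Set α) : Prop :=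
  ∀ m', m' ≠ m → (m' ∈ B ↔ m' ∈ A)

open Classical in
/-- Replace the set of nodes marked `m`. -/
def remark {α : Type w} (m : α) (A : Set (List ℕ)) (L : List ℕ → Set α) (x : List ℕ) : Set α :=
  {m' | if m' = m then x ∈ A else m' ∈ L x}

theorem eqExcept_remark {α : Type w} (m : α) (A : Set (List ℕ)) (L : List ℕ → Set α)
    (x : List ℕ) : EqExcept m (L x) (remark m A L x) := by
  intro m' hm
  simp [remark, hm]

theorem mem_remark {α : Type w} (m : α) (A : Set (List ℕ)) (L : List ℕ → Set α)
    (x : List ℕ) : m ∈ remark m A L x ↔ x ∈ A := by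
  simp [remark]

theorem Represents.update_ind {I J : Set ℕ} {C : Set K} {M : Tree K P}
    {s : ℕ → M.domain.carrier} {S : ℕ → Set M.domain.carrier} {L L' : List ℕ → Set (Mark K P)}
    {n : ℕ} (h : Represents (I \ {n}) J C M s S L)
    (hL : ∀ x ∈ M.domain.carrier, EqExcept (.ind n) (L x) (L' x)) {a : M.domain.carrier}
    (ha : ∀ x : M.domain.carrier, .ind n ∈ L' x ↔ a = x) :
    Represents I J C M (Function.update s n a) S L' where
  ind m hm x := by
    by_cases hmn : m = n
    · subst hmn; simpa using ha x
    · rw [hL x x.2 _ (by simpa using hmn), h.ind m ⟨hm, hmn⟩, Function.update_of_ne hmn]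
  set X hX x := by rw [hL x x.2 _ (by simp), h.set X hX]
  const k hk x := by rw [hL x x.2 _ (by simp), h.const k hk]
  pred p x := by rw [hL x x.2 _ (by simp), h.pred]

theorem Represents.update_set {I J : Set ℕ} {C : Set K} {M : Tree K P}
    {s : ℕ → M.domain.carrier} {S : ℕ → Set M.domain.carrier} {L L' : List ℕ → Set (Mark K P)}
    {X : ℕ} (h : Represents I (J \ {X}) C M s S L)
    (hL : ∀ x ∈ M.domain.carrier, EqExcept (.set X) (L x) (L' x)) {A : Set M.domain.carrier}
    (hA : ∀ x : M.domain.carrier, .set X ∈ L' x ↔ x ∈ A) :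
    Represents I J C M s (Function.update S X A) L' where
  ind n hn x := by rw [hL x x.2 _ (by simp), h.ind n hn]
  set Y hY x := by
    by_cases hYX : Y = X
    · subst hYX; simpa using hA x
    · rw [hL x x.2 _ (by simpa using hYX), h.set Y ⟨hY, hYX⟩, Function.update_of_ne hYX]
  const k hk x := by rw [hL x x.2 _ (by simp), h.const k hk]
  pred p x := by rw [hL x x.2 _ (by simp), h.pred]

/-- An individual is a set with one element: the mark of the variable is redistributed, subject to
occurring exactly once. -/
theorem Formula.IsRecognizable.ex {φ : Formula K P} (h : φ.IsRecognizable) (n : ℕ) :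
    (φ.ex n).IsRecognizable := by
  obtain ⟨C, hC, 𝓛, h𝓛, hd⟩ := h
  refine ⟨C, hC, _, ((recognizable_occursOnce (.ind n)).and h𝓛).exists_relabel
    (EqExcept (.ind n)), fun M s S L hL => ?_⟩
  constructor
  · rintro ⟨L', hL', ⟨a, ha, hone⟩, h⟩
    exact ⟨⟨a, ha⟩, (hd M _ S L' (hL.update_ind hL' fun x => by
      rw [hone x x.2, Subtype.ext_iff])).1 h⟩
  · rintro ⟨(a : M.domain.carrier), h⟩
    have hm : ∀ x, Mark.ind n ∈ remark (.ind n) {a.1} L x ↔ a.1 = x := fun x => by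
      rw [mem_remark, Set.mem_singleton_iff, eq_comm]
    refine ⟨remark (.ind n) {a.1} L, fun x _ => eqExcept_remark _ _ _ _,
      ⟨a.1, a.2, fun x _ => hm x⟩, (hd M _ S _ (hL.update_ind
        (fun x _ => eqExcept_remark _ _ _ _) fun x => ?_)).2 h⟩
    rw [hm, Subtype.ext_iff]

theorem Formula.IsRecognizable.exSet {φ : Formula K P} (h : φ.IsRecognizable) (X : ℕ) :
    (φ.exSet X).IsRecognizable := by
  obtain ⟨C, hC, 𝓛, h𝓛, hd⟩ := h
  refine ⟨C, hC, _, h𝓛.exists_relabel (EqExcept (.set X)), fun M s S L hL => ?_⟩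
  constructor
  · rintro ⟨L', hL', h⟩
    exact ⟨{x : M.domain.carrier | Mark.set X ∈ L' x.1},
      (hd M s _ L' (hL.update_set hL' fun x => Iff.rfl)).1 h⟩
  · rintro ⟨(A : Set M.domain.carrier), h⟩
    refine ⟨remark (.set X) (Subtype.val '' A) L,
      fun x _ => eqExcept_remark _ _ _ _,
      (hd M s _ _ (hL.update_set (fun x _ => eqExcept_remark _ _ _ _) fun x => ?_)).2 h⟩
    rw [mem_remark, Subtype.val_injective.mem_set_image]

theorem Formula.isRecognizable (φ : Formula K P) : φ.IsRecognizable := by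
  induction φ with
  | parent s t => exact isRecognizable_of_isLocal isLocal_parent s t rfl fun _ _ _ => Iff.rfl
  | dom s t => exact isRecognizable_of_isLocal isLocal_dom s t rfl fun _ _ _ => Iff.rfl
  | properDom s t =>
    have hd : (Formula.dom s t : Formula K P).IsRecognizable :=
      isRecognizable_of_isLocal isLocal_dom s t rfl fun _ _ _ => Iff.rfl
    have he : (Formula.eq s t : Formula K P).IsRecognizable :=
      isRecognizable_of_isLocal isLocal_eq s t rfl fun _ _ _ => Subtype.ext_iff
    exact (hd.and he.neg).congr (by simp [freeInd]) (by simp [freeSet]) fun _ _ _ => Iff.rfl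
  | leftOf s t => exact isRecognizable_of_isLocal isLocal_leftOf s t rfl fun _ _ _ => Iff.rfl
  | eq s t => exact isRecognizable_of_isLocal isLocal_eq s t rfl fun _ _ _ => Subtype.ext_iff
  | pred p t => exact isRecognizable_of_mark t (.pred p) rfl fun _ _ _ _ h => (h.pred p _).symm
  | mem X t => exact isRecognizable_of_mark t (.set X) rfl fun _ _ _ _ h => (h.set X rfl _).symm
  | neg φ ih => exact ih.neg
  | and φ ψ ih ih' => exact ih.and ih'
  | or φ ψ ih ih' =>
    exact (ih.neg.and ih'.neg).neg.congr rfl rfl fun _ _ _ => by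
      simp only [Model.Sat]; tauto
  | imp φ ψ ih ih' =>
    exact (ih.and ih'.neg).neg.congr rfl rfl fun _ _ _ => by
      simp only [Model.Sat]; tauto
  | iff φ ψ ih ih' =>
    exact ((ih.and ih'.neg).neg.and (ih'.and ih.neg).neg).congr
      (by simp only [freeInd, Set.union_comm, Set.union_self])
      (by simp only [freeSet, Set.union_comm, Set.union_self]) fun _ _ _ => by
      simp only [Model.Sat]; tauto
  | all x φ ih =>
    exact (ih.neg.ex x).neg.congr rfl rfl fun _ _ _ => by simp [Model.Sat]
  | ex x φ ih => exact ih.ex x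
  | allSet X φ ih =>
    exact (ih.neg.exSet X).neg.congr rfl rfl fun _ _ _ => by simp [Model.Sat]
  | exSet X φ ih => exact ih.exSet X

/-! ### From sentences to recognizable sets of labelings -/

/-- The labeling of a tree by the names of its nodes. -/
def Tree.marks (M : Tree K P) (x : List ℕ) : Set (Mark K P) :=
  {m | ∃ h : x ∈ M.domain.carrier, match m with
    | .ind _ => False
    | .set _ => False
    | .const k => M.const k = ⟨x, h⟩
    | .pred p => ⟨x, h⟩ ∈ M.pred p}

theorem Tree.represents_marks (M : Tree K P) (C : Set K) (s : ℕ → M.domain.carrier)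
    (S : ℕ → Set M.domain.carrier) : Represents ∅ ∅ C M s S M.marks where
  ind _ h := h.elim
  set _ h := h.elim
  const _ _ x := ⟨fun ⟨_, h⟩ => h, fun h => ⟨x.2, h⟩⟩
  pred _ x := ⟨fun ⟨_, h⟩ => h, fun h => ⟨x.2, h⟩⟩

theorem exists_tree_of_occursOnce (D : TreeDomain) (L : List ℕ → Set (Mark K P)) {C : Set K}
    (h : ∀ k ∈ C, OccursOnce (.const k) D.carrier L) :
    ∃ M : Tree K P, M.domain = D ∧ (∀ s S, Represents ∅ ∅ C M s S L) := by
  have h' : ∀ k, ∃ a : D.carrier, k ∈ C → ∀ x : D.carrier, .const k ∈ L x ↔ a = x := by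
    intro k
    by_cases hk : k ∈ C
    · obtain ⟨a, ha, hone⟩ := h k hk
      exact ⟨⟨a, ha⟩, fun _ x => by rw [hone x x.2, Subtype.ext_iff]⟩
    -- Constants outside `C` may name any node; the root is a default.
    · exact ⟨⟨[], D.root_mem⟩, fun h => absurd h hk⟩
  choose c hc using h'
  exact ⟨⟨D, c, fun p => {x | .pred p ∈ L x}⟩, rfl, fun s S =>
    ⟨fun _ h => h.elim, fun _ h => h.elim, hc, fun _ _ => Iff.rfl⟩⟩

/-- The labelings that represent members of a definable set of trees are recognizable. -/
theorem Definable.exists_recognizable {𝒯 : Set (Tree K P)} (h𝒯 : Definable 𝒯) {K₀ : Set K}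
    (hK₀ : K₀.Finite) :
    ∃ 𝓛 : Set (List ℕ) → (List ℕ → Set (Mark K P)) → Prop, Recognizable 𝓛 ∧
      (∀ M ∈ 𝒯, 𝓛 M.domain.carrier M.marks) ∧
      ∀ (D : TreeDomain) L, 𝓛 D.carrier L →
        ∃ M ∈ 𝒯, M.domain = D ∧ ∀ s S, Represents ∅ ∅ K₀ M s S L := by
  obtain ⟨Φ, hΦ, hsent, rfl⟩ := h𝒯
  choose C hC 𝓛 h𝓛 hd using fun φ : Formula K P => φ.isRecognizable
  -- `K` may be infinite, so unique occurrence is imposed only on the constants relevant to the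
  -- truth of `Φ` and on those to be read off from the labels.
  have hfin : (K₀ ∪ ⋃ φ ∈ Φ, C φ).Finite := hK₀.union (hΦ.biUnion fun φ _ => hC φ)
  have hdec : ∀ φ ∈ Φ, ∀ (M : Tree K P) s S L,
      Represents ∅ ∅ (K₀ ∪ ⋃ φ ∈ Φ, C φ) M s S L →
      (𝓛 φ M.domain.carrier L ↔ M.toModel.Sat s S φ) := by
    intro φ hφ M s S L hL
    refine hd φ M s S L ?_
    rw [(hsent φ hφ).1, (hsent φ hφ).2]
    exact hL.mono subset_rfl subset_rfl
      ((Set.subset_biUnion_of_mem (u := C) hφ).trans Set.subset_union_right)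
  refine ⟨_, (Recognizable.forall_mem hfin (fun k => OccursOnce (.const k)) fun k _ =>
    recognizable_occursOnce _).and (.forall_mem hΦ 𝓛 fun φ _ => h𝓛 φ), ?_, ?_⟩
  · intro M hM
    have hrep := M.represents_marks (K₀ ∪ ⋃ φ ∈ Φ, C φ)
      (fun _ => ⟨[], M.domain.root_mem⟩) fun _ => ∅
    refine ⟨fun k hk => ⟨M.const k, (M.const k).2, fun y hy => ?_⟩, fun φ hφ => ?_⟩
    · exact (hrep.const k hk ⟨y, hy⟩).trans Subtype.ext_iff
    · exact (hdec φ hφ M _ _ _ hrep).2 (hM φ hφ _ _)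
  · rintro D L ⟨hone, hφ⟩
    obtain ⟨M, rfl, hM⟩ := exists_tree_of_occursOnce D L hone
    exact ⟨M, fun φ h s S => (hdec φ h M s S L (hM s S)).1 (hφ φ h), rfl, fun s S =>
      (hM s S).mono subset_rfl subset_rfl Set.subset_union_left⟩

end Formulas

/-! ## Grammars for recognizable sets of trees -/

section Grammars

variable {Λ : Type w} {A Q : Type}

/-- The class of labels and the value that a symbol stands for. -/
def symbolState : Symbol (A × Q) ((A × Q) × Bool) → A × Q
  | .terminal p => p
  | .nonterminal p => p.1

/-- The root label class and the value `p` occur in a tree whose subtrees at the children of the root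
have the values in `l`. -/
def Step (h : Set (List ℕ) → (List ℕ → Λ) → Q) (c : Λ → A) (p : A × Q) (l : List Q) : Prop :=
  ∃ D L, IsRooted D ∧ c (L []) = p.1 ∧ h D L = p.2 ∧ (∀ i, [i] ∈ D ↔ i < l.length) ∧
    ∀ i, [i] ∈ D → l[i]? = some (h (subdomain D [i]) (sublabel L [i]))

/-- The productions of the grammar with start symbol `S`. The flag of a nonterminal marks the
root. -/
structure IsRule (h : Set (List ℕ) → (List ℕ → Λ) → Q) (c : Λ → A) (n : ℕ) (S : (A × Q) × Bool)
    (r : ContextFreeRule (A × Q) ((A × Q) × Bool)) : Prop where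
  step : Step h c r.input.1 (r.output.map fun σ => (symbolState σ).2)
  terminal : ∀ p, Symbol.terminal p ∈ r.output → Step h c p []
  nonterminal : ∀ p b, Symbol.nonterminal (p, b) ∈ r.output → b = false
  length_le : r.output.length ≤ n
  empty : r.output = [] → r.input = S

/-- There are finitely many symbols, and right-hand sides have length at most `n`. -/
theorem finite_isRule [Finite A] [Finite Q] (h : Set (List ℕ) → (List ℕ → Λ) → Q) (c : Λ → A)
    (n : ℕ) (S : (A × Q) × Bool) : {r | IsRule h c n S r}.Finite := by
  have := Fintype.ofFinite A
  have := Fintype.ofFinite Q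
  refine ((Set.finite_univ.prod (List.finite_length_le
    (Symbol (A × Q) ((A × Q) × Bool)) n)).image fun p => ⟨p.1, p.2⟩).subset fun r hr => ?_
  exact ⟨(r.input, r.output), ⟨trivial, hr.length_le⟩, rfl⟩

/-- The grammar of the trees whose root has label class and value `p`. -/
noncomputable def stateGrammar [Finite A] [Finite Q] (h : Set (List ℕ) → (List ℕ → Λ) → Q)
    (c : Λ → A) (n : ℕ) (p : A × Q) :
    ((A × Q) × Bool) × Finset (ContextFreeRule (A × Q) ((A × Q) × Bool)) :=
  ((p, true), (finite_isRule h c n (p, true)).toFinset)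

theorem mem_stateGrammar [Finite A] [Finite Q] {h : Set (List ℕ) → (List ℕ → Λ) → Q}
    {c : Λ → A} {n : ℕ} {p : A × Q} {r : ContextFreeRule (A × Q) ((A × Q) × Bool)} :
    r ∈ (grammar (stateGrammar h c n p)).rules ↔ IsRule h c n (p, true) r :=
  Set.Finite.mem_toFinset _

theorem emptyOnlyAtStart_stateGrammar [Finite A] [Finite Q]
    (h : Set (List ℕ) → (List ℕ → Λ) → Q) (c : Λ → A) (n : ℕ) (p : A × Q) :
    EmptyOnlyAtStart (grammar (stateGrammar h c n p)) := by
  intro r hr h0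
  refine ⟨(mem_stateGrammar.1 hr).empty h0, fun r' hr' hmem => ?_⟩
  exact Bool.noConfusion ((mem_stateGrammar.1 hr').nonterminal p true hmem)

/-! ### From derivation trees to labeled trees -/

/-- At each node of a derivation tree, some tree has the label class and the value of the node at its
root and the values of the children of the node at the children of its root. -/
theorem IsDerivationTree.exists_step [Finite A] [Finite Q]
    {h : Set (List ℕ) → (List ℕ → Λ) → Q} {c : Λ → A} {n : ℕ} {p : A × Q}
    {E : LabeledTree (Symbol (A × Q) ((A × Q) × Bool))}
    (hE : IsDerivationTree (grammar (stateGrammar h c n p)) E) (x : E.domain.carrier) :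
    ∃ D L, IsRooted D ∧ c (L []) = (symbolState (E.label x)).1 ∧
      h D L = (symbolState (E.label x)).2 ∧ (∀ i, x.1 ++ [i] ∈ E.domain.carrier ↔ [i] ∈ D) ∧
      ∀ i (hi : x.1 ++ [i] ∈ E.domain.carrier),
        (symbolState (E.label ⟨x.1 ++ [i], hi⟩)).2 = h (subdomain D [i]) (sublabel L [i]) := by
  rcases hx : E.label x with a | a
  -- A terminal has no production of its own. It is not at the root, so the production used at its
  -- parent certifies that a one-node tree realizes it.
  · have hstep : Step h c a [] := by
      obtain ⟨x, hxE⟩ := x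
      obtain rfl | ⟨y, i, rfl⟩ := List.eq_nil_or_concat x
      · have := hE.root
        rw [hx] at this
        cases this
      · rw [List.concat_eq_append] at hxE
        have hy := E.domain.prefix_mem y [i] hxE
        rcases hya : E.label ⟨y, hy⟩ with b | b
        · exact absurd hxE (hE.terminal ⟨y, hy⟩ b hya i)
        · obtain ⟨r, hr, -, -, hout⟩ := hE.nonterminal ⟨y, hy⟩ b hya
          have hi := hout i hxE
          simp only [List.concat_eq_append] at hx
          rw [hx] at hi
          exact (mem_stateGrammar.1 hr).terminal a (List.mem_of_getElem? hi)
    obtain ⟨D, L, hD, hc, hh, hch, -⟩ := hstep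
    refine ⟨D, L, hD, hc, hh, fun i => ?_, fun i hi => absurd hi (hE.terminal x a hx i)⟩
    simpa [hch] using hE.terminal x a hx i
  · obtain ⟨r, hr, hin, hlen, hout⟩ := hE.nonterminal x a hx
    obtain ⟨D, L, hD, hc, hh, hch, hval⟩ := (mem_stateGrammar.1 hr).step
    rw [hin] at hc hh
    have hiff : ∀ i, x.1 ++ [i] ∈ E.domain.carrier ↔ [i] ∈ D := fun i => by
      rw [hlen, hch, List.length_map]
    refine ⟨D, L, hD, hc, hh, hiff, fun i hi => ?_⟩
    have := hval i ((hiff i).1 hi)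
    rw [List.getElem?_map, hout i hi] at this
    exact Option.some.inj this

theorem IsDerivationTree.exists_labeling [Finite A] [Finite Q]
    {h : Set (List ℕ) → (List ℕ → Λ) → Q} (hh : IsCongruence h) {c : Λ → A} {n : ℕ} {p : A × Q}
    {E : LabeledTree (Symbol (A × Q) ((A × Q) × Bool))}
    (hE : IsDerivationTree (grammar (stateGrammar h c n p)) E) :
    ∃ L : List ℕ → Λ, (∀ x : E.domain.carrier, c (L x) = (symbolState (E.label x)).1) ∧
      h E.domain.carrier L = p.2 := by
  classical
  choose D L hD hc hval hiff hch using hE.exists_step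
  -- Each node takes the root label of its local witness. The label off the domain is arbitrary; the
  -- one used at the root serves, as `Λ` is not assumed inhabited.
  let M : List ℕ → Λ := fun x =>
    if hx : x ∈ E.domain.carrier then L ⟨x, hx⟩ [] else L ⟨[], E.domain.root_mem⟩ []
  have hM : ∀ x : E.domain.carrier, M x = L x [] := fun x => dif_pos x.2
  obtain ⟨N, hN⟩ := (hE.finite.image List.length).bddAbove
  -- Induction from the leaves upwards: `N` bounds the depth of all nodes, so `m = 0` is vacuous. In
  -- the step, the congruence compares the subtree at `x` with the witness at `x`.
  have key : ∀ (m : ℕ) (x : E.domain.carrier), N < x.1.length + m →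
      h (subdomain E.domain.carrier x) (sublabel M x) = (symbolState (E.label x)).2 := by
    intro m
    induction m with
    | zero =>
      intro x hx
      exact absurd (hN ⟨x, x.2, rfl⟩) (by omega)
    | succ m ih =>
      intro x hx
      rw [← hval x]
      refine hh _ _ _ _ (E.domain.isRooted.subdomain x.2) (hD x) ?_ (hiff x) fun i hi => ?_
      · simpa [sublabel] using hM x
      · rw [subdomain_subdomain, sublabel_sublabel, ← hch x i hi]
        exact ih ⟨x.1 ++ [i], hi⟩ (by simp only [List.length_append, List.length_singleton]; omega)
  refine ⟨M, fun x => by rw [hM, hc], ?_⟩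
  have h0 := key (N + 1) ⟨[], E.domain.root_mem⟩ (by simp)
  rw [hE.root] at h0
  exact h0

/-! ### From labeled trees to derivation trees -/

theorem TreeDomain.exists_arity (D : TreeDomain) (x : List ℕ) {n : ℕ}
    (hn : ∀ i, x ++ [i] ∈ D.carrier → i < n) : ∃ k ≤ n, ∀ i, x ++ [i] ∈ D.carrier ↔ i < k := by
  classical
  have hex : ∃ i, x ++ [i] ∉ D.carrier := ⟨n, fun h => lt_irrefl _ (hn n h)⟩
  refine ⟨Nat.find hex, Nat.find_min' hex fun h => lt_irrefl _ (hn n h), fun i => ?_⟩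
  constructor
  · intro hi
    by_contra! hle
    obtain hlt | heq := hle.lt_or_eq
    · exact Nat.find_spec hex (D.sibling_mem x i _ hi hlt)
    · exact Nat.find_spec hex (heq ▸ hi)
  · exact fun hi => not_not.1 (Nat.find_min hex hi)

/-- The label class and the value at a node. -/
def nodeState (h : Set (List ℕ) → (List ℕ → Λ) → Q) (c : Λ → A) (D : TreeDomain)
    (L : List ℕ → Λ) (x : List ℕ) : A × Q :=
  (c (L x), h (subdomain D.carrier x) (sublabel L x))

open Classical in
/-- The derivation tree for a labeled tree. -/
noncomputable def derivationTree (h : Set (List ℕ) → (List ℕ → Λ) → Q) (c : Λ → A)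
    (D : TreeDomain) (L : List ℕ → Λ) : LabeledTree (Symbol (A × Q) ((A × Q) × Bool)) where
  domain := D
  label x :=
    -- The root is the start symbol even if it is a leaf; this is the one use of an empty
    -- production.
    if x.1 = [] then .nonterminal (nodeState h c D L x, true)
    else if ∃ i : ℕ, x.1 ++ [i] ∈ D.carrier then .nonterminal (nodeState h c D L x, false)
    else .terminal (nodeState h c D L x)

section DerivationTree

variable {h : Set (List ℕ) → (List ℕ → Λ) → Q} {c : Λ → A} {D : TreeDomain} {L : List ℕ → Λ}

theorem symbolState_derivationTree (x : D.carrier) :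
    symbolState ((derivationTree h c D L).label x) = nodeState h c D L x := by
  unfold derivationTree
  dsimp only
  split_ifs <;> rfl

theorem derivationTree_eq_terminal {x : D.carrier} {p : A × Q}
    (hx : (derivationTree h c D L).label x = .terminal p) :
    p = nodeState h c D L x ∧ ∀ i : ℕ, x.1 ++ [i] ∉ D.carrier := by
  unfold derivationTree at hx
  dsimp only at hx
  split_ifs at hx with h1 h2
  exact ⟨(Symbol.terminal.inj hx).symm, not_exists.1 h2⟩

theorem derivationTree_eq_nonterminal {x : D.carrier} {p : A × Q} {b : Bool}
    (hx : (derivationTree h c D L).label x = .nonterminal (p, b)) :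
    p = nodeState h c D L x ∧
      (x.1 = [] ∧ b = true ∨ x.1 ≠ [] ∧ b = false ∧ ∃ i : ℕ, x.1 ++ [i] ∈ D.carrier) := by
  unfold derivationTree at hx
  dsimp only at hx
  split_ifs at hx with h1 h2
  · obtain ⟨rfl, rfl⟩ := Prod.mk.inj (Symbol.nonterminal.inj hx)
    exact ⟨rfl, .inl ⟨h1, rfl⟩⟩
  · obtain ⟨rfl, rfl⟩ := Prod.mk.inj (Symbol.nonterminal.inj hx)
    exact ⟨rfl, .inr ⟨h1, rfl, h2⟩⟩

theorem step_nodeState {x : List ℕ} (hx : x ∈ D.carrier) {l : List Q}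
    (hl : ∀ i, x ++ [i] ∈ D.carrier ↔ i < l.length)
    (hval : ∀ i, x ++ [i] ∈ D.carrier → l[i]? = some (nodeState h c D L (x ++ [i])).2) :
    Step h c (nodeState h c D L x) l := by
  refine ⟨subdomain D.carrier x, sublabel L x, D.isRooted.subdomain hx, ?_, rfl, hl,
    fun i hi => ?_⟩
  · simp [sublabel, nodeState]
  · rw [hval i hi, subdomain_subdomain, sublabel_sublabel]
    rfl

theorem isDerivationTree_derivationTree [Finite A] [Finite Q] {n : ℕ}
    (hfin : D.carrier.Finite) (hn : ∀ x i, x ++ [i] ∈ D.carrier → i < n) :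
    IsDerivationTree (grammar (stateGrammar h c n (nodeState h c D L [])))
      (derivationTree h c D L) where
  finite := hfin
  root := by simp [derivationTree, stateGrammar]
  terminal x a hx := (derivationTree_eq_terminal hx).2
  nonterminal := by
    rintro x ⟨p, b⟩ hx
    obtain ⟨rfl, hb⟩ := derivationTree_eq_nonterminal hx
    obtain ⟨k, hkn, hk⟩ := D.exists_arity x.1 (hn x.1)
    let out := List.ofFn fun i : Fin k =>
      (derivationTree h c D L).label ⟨x.1 ++ [i.1], (hk i).2 i.2⟩
    have hlen : out.length = k := List.length_ofFn
    have hget : ∀ (i : ℕ) (hi : x.1 ++ [i] ∈ D.carrier),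
        out[i]? = some ((derivationTree h c D L).label ⟨x.1 ++ [i], hi⟩) := by
      intro i hi
      simp [out, (hk i).1 hi]
    have hmem : ∀ σ ∈ out, ∃ y : D.carrier, y.1 ≠ [] ∧ (derivationTree h c D L).label y = σ := by
      intro σ hσ
      obtain ⟨i, rfl⟩ := (List.mem_ofFn' _ _).1 hσ
      exact ⟨_, by simp, rfl⟩
    refine ⟨⟨(nodeState h c D L x, b), out⟩, mem_stateGrammar.2 ⟨?_, ?_, ?_, ?_, ?_⟩, rfl,
      fun i => by rw [hlen]; exact hk i, hget⟩
    · refine step_nodeState (D := D) x.2 (fun i => by rw [hk, List.length_map, hlen]) fun i hi => ?_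
      rw [List.getElem?_map, hget i hi, Option.map_some]
      exact congrArg (fun q : A × Q => some q.2) (symbolState_derivationTree (⟨_, hi⟩ : D.carrier))
    · intro p hp
      obtain ⟨y, -, hy⟩ := hmem _ hp
      obtain ⟨rfl, hleaf⟩ := derivationTree_eq_terminal hy
      exact step_nodeState y.2 (fun i => by simp [hleaf]) fun i hi => absurd hi (hleaf i)
    · intro p b' hp
      obtain ⟨y, hy0, hy⟩ := hmem _ hp
      obtain ⟨-, ⟨h0, -⟩ | ⟨-, hb', -⟩⟩ := derivationTree_eq_nonterminal hy
      · exact absurd h0 hy0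
      · exact hb'
    · exact hlen.trans_le hkn
    · intro h0
      have hk0 : k = 0 := by rw [← hlen]; exact List.length_eq_zero_iff.2 h0
      -- A nonterminal below the root has a child by construction, so an empty right-hand side
      -- occurs only at the root.
      obtain ⟨hx0, rfl⟩ | ⟨-, -, i, hi⟩ := hb
      · exact congrArg (fun y => (nodeState h c D L y, true)) hx0
      · exact absurd ((hk i).1 hi) (by omega)

end DerivationTree

/-- A recognizable set of finite trees with bounded branching is, up to a projection, the set of
derivation trees of a finite set of grammars. -/
theorem Recognizable.exists_grammars [Finite A] (c : Λ → A)
    {𝓛 : Set (List ℕ) → (List ℕ → Λ) → Prop} (h𝓛 : Recognizable 𝓛) (n : ℕ)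
    (hfin : ∀ (D : TreeDomain) L, 𝓛 D.carrier L → D.carrier.Finite)
    (hn : ∀ (D : TreeDomain) L, 𝓛 D.carrier L → ∀ x i, x ++ [i] ∈ D.carrier → i < n) :
    ∃ (T N : Type) (_ : Finite T) (_ : Finite N)
      (𝒢 : Set (N × Finset (ContextFreeRule T N))) (π : Symbol T N → A),
      𝒢.Finite ∧ (∀ G ∈ 𝒢, EmptyOnlyAtStart (grammar G)) ∧
      {E : LabeledTree A | ∃ L, 𝓛 E.domain.carrier L ∧ ∀ x, E.label x = c (L x)} =
        LabeledTree.map π '' generatedTrees 𝒢 := by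
  obtain ⟨Q, hQ, h, F, hh, hF⟩ := h𝓛
  refine ⟨A × Q, (A × Q) × Bool, inferInstance, inferInstance,
    stateGrammar h c n '' {p | p.2 ∈ F}, fun σ => (symbolState σ).1, (Set.toFinite _).image _, ?_, ?_⟩
  · rintro _ ⟨p, -, rfl⟩
    exact emptyOnlyAtStart_stateGrammar h c n p
  · ext E
    constructor
    · rintro ⟨L, hL, hE⟩
      refine ⟨derivationTree h c E.domain L, ⟨_, ⟨nodeState h c E.domain L [], ?_, rfl⟩,
        isDerivationTree_derivationTree (hfin _ L hL) (hn _ L hL)⟩, ?_⟩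
      · exact (hF _ _).1 hL
      · obtain ⟨D, l⟩ := E
        obtain rfl : l = fun x : D.carrier => c (L x.1) := funext hE
        exact congrArg (LabeledTree.mk D) (funext fun x =>
          congrArg Prod.fst (symbolState_derivationTree x))
    · rintro ⟨E, ⟨_, ⟨p, hp, rfl⟩, hE⟩, rfl⟩
      obtain ⟨L, hL, hval⟩ := hE.exists_labeling hh
      exact ⟨L, (hF _ _).2 (by
        change h E.domain.carrier L ∈ F
        rwa [hval]), fun x => (hL x).symm⟩

end Grammars

/-! ### Reading off the labels and the main theorem -/

/-- The constants and predicates given by a label, as far as `K₀` and `P₀` are concerned. -/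
def Mark.names {K : Type u} {P : Type v} (K₀ : Set K) (P₀ : Set P) (m : Set (Mark K P)) :
    Set K × Set P :=
  ({k | k ∈ K₀ ∧ .const k ∈ m}, {p | p ∈ P₀ ∧ .pred p ∈ m})

theorem Mark.finite_range_names {K : Type u} {P : Type v} {K₀ : Set K} {P₀ : Set P}
    (hK₀ : K₀.Finite) (hP₀ : P₀.Finite) : (Set.range (Mark.names K₀ P₀)).Finite := by
  refine (hK₀.finite_subsets.prod hP₀.finite_subsets).subset ?_
  rintro _ ⟨m, rfl⟩
  exact ⟨fun k hk => hk.1, fun p hp => hp.1⟩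

theorem Represents.labeled {K : Type u} {P : Type v} {K₀ : Set K} (P₀ : Set P) {I J : Set ℕ}
    {M : Tree K P} {s : ℕ → M.domain.carrier} {S : ℕ → Set M.domain.carrier}
    {L : List ℕ → Set (Mark K P)} (h : Represents I J K₀ M s S L) :
    M.labeled K₀ P₀ = ⟨M.domain, fun x => Mark.names K₀ P₀ (L x)⟩ := by
  unfold Tree.labeled
  congr 1
  ext x a
  · simp +contextual [Mark.names, h.const]
  · simp [Mark.names, h.pred]

end LKP

theorem theorem2 {K : Type*} {P : Type*} (𝒯 : Set (LKP.Tree K P))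
    (hdef : LKP.Definable 𝒯) (hfin : LKP.AllFinite 𝒯) (hbdd : LKP.BoundedBranching 𝒯)
    (K₀ : Set K) (P₀ : Set P) (hK₀ : K₀.Finite) (hP₀ : P₀.Finite) :
    ∃ (T N : Type) (_ : Finite T) (_ : Finite N)
      (𝒢 : Set (N × Finset (ContextFreeRule T N))) (π : Symbol T N → Set K × Set P),
      𝒢.Finite ∧ (∀ G ∈ 𝒢, LKP.EmptyOnlyAtStart (LKP.grammar G)) ∧
      LKP.Tree.labeled K₀ P₀ '' 𝒯 = LKP.LabeledTree.map π '' LKP.generatedTrees 𝒢 := by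
  obtain ⟨𝓛, h𝓛, hmarks, hrep⟩ := hdef.exists_recognizable hK₀
  obtain ⟨n, hn⟩ := hbdd
  have : Finite (Set.range (LKP.Mark.names K₀ P₀)) := LKP.Mark.finite_range_names hK₀ hP₀
  -- The label classes must live in `Type`, while `K` and `P` are in arbitrary universes; hence the
  -- finitely many labels are numbered, and `e.symm` decodes them in the final projection.
  obtain ⟨k, ⟨e⟩⟩ := Finite.exists_equiv_fin (Set.range (LKP.Mark.names K₀ P₀))
  obtain ⟨T, N, hT, hN, 𝒢, π, h𝒢, hempty, heq⟩ := h𝓛.exists_grammars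
    (fun m => e (Set.rangeFactorization (LKP.Mark.names K₀ P₀) m)) n
    (fun D L hL => by obtain ⟨M, hM, rfl, -⟩ := hrep D L hL; exact hfin M hM)
    (fun D L hL => by obtain ⟨M, hM, rfl, -⟩ := hrep D L hL; exact hn M hM)
  refine ⟨T, N, hT, hN, 𝒢, fun σ => (e.symm (π σ)).1, h𝒢, hempty, ?_⟩
  have hcomp : LKP.LabeledTree.map (fun σ => (e.symm (π σ)).1) '' LKP.generatedTrees 𝒢 =
      LKP.LabeledTree.map (fun a => (e.symm a).1) ''
        (LKP.LabeledTree.map π '' LKP.generatedTrees 𝒢) := by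
    rw [Set.image_image]
    rfl
  rw [hcomp, ← heq]
  ext E
  constructor
  · rintro ⟨M, hM, rfl⟩
    refine ⟨⟨M.domain, fun x => e (Set.rangeFactorization (LKP.Mark.names K₀ P₀) (M.marks x))⟩,
      ⟨M.marks, hmarks M hM, fun _ => rfl⟩, ?_⟩
    rw [(M.represents_marks K₀ (fun _ => ⟨[], M.domain.root_mem⟩) fun _ => ∅).labeled P₀]
    simp [LKP.LabeledTree.map, Set.rangeFactorization]
  · rintro ⟨⟨D, l⟩, ⟨L, hL, hl⟩, rfl⟩
    obtain ⟨M, hM, rfl, hML⟩ := hrep _ L hL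
    refine ⟨M, hM, ?_⟩
    obtain rfl : l = fun x : M.domain.carrier =>
        e (Set.rangeFactorization (LKP.Mark.names K₀ P₀) (L x.1)) := funext hl
    rw [(hML (fun _ => ⟨[], M.domain.root_mem⟩) fun _ => ∅).labeled P₀]
    simp [LKP.LabeledTree.map, Set.rangeFactorization]
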